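/- Let $K$ be a field. For a monic polynomial $P=X^d+a_{d-1}X^{d-1}+\dots+a_0\in K[X]$ of degree $d\ge 1$ let $[P]\in\operatorname{M}_d(K)$ be its companion matrix (ones directly below the diagonal, last column $(-a_0,\dots,-a_{d-1})^t$, zeros elsewhere), and let $\sigma\oplus\tau$ denote the block diagonal matrix with blocks $\sigma,\tau$. Let $\operatorname{GL}_\infty(K)=\varinjlim_{n\ge 1}\operatorname{GL}_n(K)$ with respect to the transition homomorphisms $\operatorname{GL}_n(K)\to\operatorname{GL}_{n+k}(K)$, $\sigma\mapsto e_{k\times k}\oplus\sigma$, where $e_{k\times k}$ is the identity matrix, and write $[\sigma]_\infty$ for the class of $\sigma\in\operatorname{GL}_n(K)$. For $\sigma\in\operatorname{GL}_\infty(K)$ let $n_\sigma$ be the least positive integer $n$ such that $\sigma$ has a representative in $\operatorname{GL}_n(K)$, and for $n\ge n_\sigma$ let $\sigma^{(n)}$ be the unique representative of $\sigma$ in $\operatorname{GL}_n(K)$. Then the following hold. 1. For every $n\ge 1$ and every $A\in\operatorname{M}_n(K)$ there is exactly one finite sequence $P_1,\dots,P_r$ of nonconstant monic polynomials in $K[X]$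 with $P_1\mid P_2\mid\dots\mid P_r$ such that $A$ is similar to $F(A):=[P_1]\oplus\dots\oplus[P_r]$ (the Frobenius form of $A$). 2. For every $\sigma\in\operatorname{GL}_\infty(K)$ there is an $s\ge n_\sigma$ such that $[F(\sigma^{(s)})]_\infty=[F(\sigma^{(t)})]_\infty$ for all $t\ge s$. Hence the stabilized Frobenius form $F(\sigma):=[F(\sigma^{(s)})]_\infty\in\operatorname{GL}_\infty(K)$ is well defined, that is, it does not depend on the choice of such an $s$. 3. For all $\sigma,\tau\in\operatorname{GL}_\infty(K)$: $\sigma$ and $\tau$ are conjugate in $\operatorname{GL}_\infty(K)$ if and only if $F(\sigma)=F(\tau)$. -/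

import Mathlib

open Polynomial

noncomputable section

namespace StableGL

/-- The companion matrix `[P]` of `P = X^d + a_{d-1} X^{d-1} + ... + a_0`, `d = P.natDegree`:
ones below the diagonal, last column `(-a_0, ..., -a_{d-1})`. (Used for monic `P` only.) -/
def companion {K : Type*} [Field K] (P : K[X]) :
    Matrix (Fin P.natDegree) (Fin P.natDegree) K :=
  Matrix.of fun i j =>
    if (j : ℕ) + 1 = P.natDegree then -P.coeff i
    else if (i : ℕ) = (j : ℕ) + 1 then 1 else 0

/-- The direct sum `σ ⊕ τ` of square matrices: block diagonal, `σ` in the upper left corner. -/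
def directSum {K : Type*} [Field K] {m n : ℕ}
    (σ : Matrix (Fin m) (Fin m) K) (τ : Matrix (Fin n) (Fin n) K) :
    Matrix (Fin (m + n)) (Fin (m + n)) K :=
  Matrix.reindex finSumFinEquiv finSumFinEquiv (Matrix.fromBlocks σ 0 0 τ)

/-- A square matrix of size `m` regarded as one of size `n`, where `m = n`. -/
def castSize {K : Type*} {m n : ℕ} (h : m = n) (σ : Matrix (Fin m) (Fin m) K) :
    Matrix (Fin n) (Fin n) K :=
  Matrix.reindex (finCongr h) (finCongr h) σ

/-- `[P₁] ⊕ ... ⊕ [P_r]` for a list `P₁, ..., P_r` of polynomials. -/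
def companionSum {K : Type*} [Field K] : (L : List K[X]) →
    Matrix (Fin (L.map natDegree).sum) (Fin (L.map natDegree).sum) K
  | [] => 0
  | P :: L => castSize (by simp) (directSum (companion P) (companionSum L))

/-- Similarity of square matrices: `σ = ρ τ ρ⁻¹` for some invertible `ρ`. -/
def Similar {K : Type*} [Field K] {n : ℕ} (σ τ : Matrix (Fin n) (Fin n) K) : Prop :=
  ∃ ρ : GL (Fin n) K,
    σ = (ρ : Matrix (Fin n) (Fin n) K) * τ * ((ρ⁻¹ : GL (Fin n) K) : Matrix (Fin n) (Fin n) K)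

/-- `L = P₁, ..., P_r` consists of nonconstant monic polynomials with `P₁ ∣ P₂ ∣ ... ∣ P_r`,
and `σ` is similar to `[P₁] ⊕ ... ⊕ [P_r]`. -/
structure IsInvariantFactors {K : Type*} [Field K] {n : ℕ}
    (σ : Matrix (Fin n) (Fin n) K) (L : List K[X]) : Prop where
  monic : ∀ P ∈ L, P.Monic
  nonconstant : ∀ P ∈ L, 0 < P.natDegree
  chain : L.IsChain (· ∣ ·)
  similar : ∃ h : (L.map natDegree).sum = n, Similar σ (castSize h (companionSum L))

open Classical in
/-- The Frobenius form `F(σ) = [P₁] ⊕ ... ⊕ [P_r]` of `σ`, where `P₁, ..., P_r` are the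
invariant factors of `σ`. The second branch is never taken, since every matrix has
invariant factors. -/
def frobeniusForm {K : Type*} [Field K] {n : ℕ} (σ : Matrix (Fin n) (Fin n) K) :
    Matrix (Fin n) (Fin n) K :=
  if h : ∃ L : List K[X], IsInvariantFactors σ L then
    castSize h.choose_spec.similar.choose (companionSum h.choose)
  else σ

theorem similar_frobeniusForm {K : Type*} [Field K] {n : ℕ} (σ : Matrix (Fin n) (Fin n) K) :
    Similar σ (frobeniusForm σ) := by
  unfold frobeniusForm
  split_ifs with h
  · exact h.choose_spec.similar.choose_spec
  · exact ⟨1, by simp⟩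

theorem isUnit_frobeniusForm {K : Type*} [Field K] {n : ℕ} (σ : GL (Fin n) K) :
    IsUnit (frobeniusForm (σ : Matrix (Fin n) (Fin n) K)) := by
  obtain ⟨ρ, hρ⟩ := similar_frobeniusForm (σ : Matrix (Fin n) (Fin n) K)
  generalize frobeniusForm (σ : Matrix (Fin n) (Fin n) K) = F at hρ ⊢
  refine ⟨ρ⁻¹ * σ * ρ, ?_⟩
  rw [Units.val_mul, Units.val_mul, hρ, ← mul_assoc, ← mul_assoc, Units.inv_mul, one_mul,
    mul_assoc, Units.inv_mul, mul_one]

/-- The Frobenius form of an invertible matrix, as an invertible matrix. -/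
def frobeniusGL {K : Type*} [Field K] {n : ℕ} (σ : GL (Fin n) K) : GL (Fin n) K :=
  (isUnit_frobeniusForm σ).unit

/-- For `m ≤ n`, the matrix `e ⊕ σ` of size `n`, where `e` is the identity matrix of
size `n - m`. -/
def pad {K : Type*} [Field K] {m n : ℕ} (h : m ≤ n) (σ : Matrix (Fin m) (Fin m) K) :
    Matrix (Fin n) (Fin n) K :=
  castSize (Nat.sub_add_cancel h) (directSum (1 : Matrix (Fin (n - m)) (Fin (n - m)) K) σ)

theorem pad_one {K : Type*} [Field K] {m n : ℕ} (h : m ≤ n) :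
    pad h (1 : Matrix (Fin m) (Fin m) K) = 1 := by
  simp [pad, castSize, directSum, Matrix.fromBlocks_one]

theorem pad_mul {K : Type*} [Field K] {m n : ℕ} (h : m ≤ n)
    (σ τ : Matrix (Fin m) (Fin m) K) : pad h (σ * τ) = pad h σ * pad h τ := by
  simp only [pad, castSize, directSum, Matrix.reindex_apply, Matrix.submatrix_mul_equiv,
    Matrix.fromBlocks_multiply]
  simp

theorem pad_apply {K : Type*} [Field K] {m n : ℕ} (h : m ≤ n)
    (σ : Matrix (Fin m) (Fin m) K) (i j : Fin n) :
    pad h σ i j = if H : n - m ≤ i ∧ n - m ≤ j then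
      σ ⟨i - (n - m), by omega⟩ ⟨j - (n - m), by omega⟩ else if i = j then 1 else 0 := by
  have key : ∀ i : Fin (n - m + m), (∃ a : Fin (n - m), i = Fin.castAdd m a) ∨
      (∃ a : Fin m, i = Fin.natAdd (n - m) a) := fun i =>
    Fin.addCases (fun a => Or.inl ⟨a, rfl⟩) (fun a => Or.inr ⟨a, rfl⟩) i
  obtain ⟨i, rfl⟩ := (finCongr (Nat.sub_add_cancel h)).surjective i
  obtain ⟨j, rfl⟩ := (finCongr (Nat.sub_add_cancel h)).surjective j
  rcases key i with ⟨a, rfl⟩ | ⟨a, rfl⟩ <;> rcases key j with ⟨b, rfl⟩ | ⟨b, rfl⟩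
  · have : ¬ (n - m ≤ (a : ℕ)) := by omega
    simp [pad, castSize, directSum, Matrix.one_apply, this, Fin.ext_iff]
  · have : ¬ (n - m ≤ (a : ℕ)) := by omega
    have h2 : ¬ ((a : ℕ) = n - m + b) := by omega
    simp [pad, castSize, directSum, this, h2, Fin.ext_iff]
  · have : ¬ (n - m ≤ (b : ℕ)) := by omega
    have h2 : ¬ (n - m + a = (b : ℕ)) := by omega
    simp [pad, castSize, directSum, this, h2, Fin.ext_iff]
  · simp [pad, castSize, directSum]

theorem pad_self {K : Type*} [Field K] {m : ℕ} (σ : Matrix (Fin m) (Fin m) K) :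
    pad le_rfl σ = σ := by
  ext i j
  simp [pad_apply]

theorem pad_pad {K : Type*} [Field K] {l m n : ℕ} (h : l ≤ m) (h' : m ≤ n)
    (σ : Matrix (Fin l) (Fin l) K) : pad h' (pad h σ) = pad (h.trans h') σ := by
  ext i j
  simp only [pad_apply, Fin.ext_iff]
  split_ifs <;> first | rfl | omega | (congr 2 <;> omega)

theorem pad_injective {K : Type*} [Field K] {m n : ℕ} (h : m ≤ n) :
    Function.Injective (pad (K := K) h) := by
  intro σ τ e
  have := (Matrix.reindex _ _).injective ((Matrix.reindex _ _).injective e)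
  exact (Matrix.fromBlocks_inj.1 this).2.2.2

/-- The transition homomorphism `GL_m(K) → GL_n(K)`, `σ ↦ e ⊕ σ`, for `m ≤ n`. -/
def transition (K : Type*) [Field K] (m n : ℕ+) (h : m ≤ n) :
    GL (Fin m) K →* GL (Fin n) K :=
  Units.map
    { toFun := pad (show (m : ℕ) ≤ n from h)
      map_one' := pad_one _
      map_mul' := pad_mul _ }

instance directedSystem (K : Type*) [Field K] :
    DirectedSystem (fun n : ℕ+ => GL (Fin n) K) (transition K · · ·) where
  map_self _ _ := Units.ext (pad_self _)
  map_map k j i h h' _ :=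
    Units.ext (pad_pad (show (i : ℕ) ≤ j from h) (show (j : ℕ) ≤ k from h') _)

/-- The stable general linear group `GL_∞(K)`: the direct limit of the groups `GL_n(K)`,
`n = 1, 2, ...`, along the transition homomorphisms `σ ↦ e ⊕ σ`. -/
abbrev GLInf (K : Type*) [Field K] : Type _ :=
  DirectLimit (fun n : ℕ+ => GL (Fin n) K) (transition K)

/-- The class `[σ]_∞` in `GL_∞(K)` of an invertible matrix `σ`. -/
def stableClass {K : Type*} [Field K] {n : ℕ+} (σ : GL (Fin n) K) : GLInf K := ⟦⟨n, σ⟩⟧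

theorem stableClass_transition {K : Type*} [Field K] {m n : ℕ+} (h : m ≤ n)
    (σ : GL (Fin m) K) : stableClass (transition K m n h σ) = stableClass σ :=
  DirectLimit.mk_apply (F := fun n : ℕ+ => GL (Fin n) K) (f := transition K) m n σ h

theorem stableClass_injective {K : Type*} [Field K] {n : ℕ+} :
    Function.Injective (stableClass : GL (Fin n) K → GLInf K) := by
  intro σ τ e
  obtain ⟨k, h, _, e'⟩ := Quotient.exact e
  replace e' : transition K n k h σ = transition K n k h τ := e'
  exact Units.ext (pad_injective h (Units.ext_iff.1 e'))

theorem exists_representative {K : Type*} [Field K] (σ : GLInf K) :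
    ∃ n : ℕ+, ∃ A : GL (Fin n) K, stableClass A = σ := by
  obtain ⟨n, A, rfl⟩ := DirectLimit.exists_eq_mk _ σ
  exact ⟨n, A, rfl⟩

open Classical in
/-- `n_σ`: the least positive integer `n` such that `σ` has a representative in `GL_n(K)`. -/
def minSize {K : Type*} [Field K] (σ : GLInf K) : ℕ+ := PNat.find (exists_representative σ)

theorem existsUnique_representative {K : Type*} [Field K] (σ : GLInf K) (n : ℕ+)
    (h : minSize σ ≤ n) : ∃! A : GL (Fin n) K, stableClass A = σ := by
  obtain ⟨A, hA⟩ : ∃ A : GL (Fin (minSize σ)) K, stableClass A = σ := by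
    classical
    exact PNat.find_spec (exists_representative σ)
  refine ⟨transition K _ n h A, (stableClass_transition h A).trans hA, fun B hB => ?_⟩
  exact stableClass_injective (hB.trans ((stableClass_transition h A).trans hA).symm)

/-- `σ^(n)`: the unique representative of `σ` in `GL_n(K)`, for `n ≥ n_σ`. -/
def representative {K : Type*} [Field K] (σ : GLInf K) (n : ℕ+) (h : minSize σ ≤ n) :
    GL (Fin n) K :=
  (existsUnique_representative σ n h).choose

/-- `s ≥ n_σ`, and `[F(σ^(s))]_∞ = [F(σ^(t))]_∞` for all `t ≥ s`. -/
def StabilizesAt {K : Type*} [Field K] (σ : GLInf K) (s : ℕ+) : Prop :=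
  ∃ hs : minSize σ ≤ s, ∀ (t : ℕ+) (ht : s ≤ t),
    stableClass (frobeniusGL (representative σ s hs)) =
      stableClass (frobeniusGL (representative σ t (hs.trans ht)))

open Classical in
/-- The stabilized Frobenius form `F(σ) = [F(σ^(s))]_∞` of `σ ∈ GL_∞(K)`, for any `s` from which
on the classes `[F(σ^(n))]_∞` no longer change. The second branch is never taken, since such an
`s` exists. -/
def stableFrobeniusForm {K : Type*} [Field K] (σ : GLInf K) : GLInf K :=
  if h : ∃ s : ℕ+, StabilizesAt σ s then
    stableClass (frobeniusGL (representative σ h.choose h.choose_spec.choose))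
  else 1

end StableGL

end

/-! A matrix `σ` makes `K^n` a `K[X]`-module, with `X` acting as `σ`, and similarity is isomorphism
of these modules (`similar_iff`). The companion matrix of `P` gives `K[X]/(P)`, so Frobenius forms
are decompositions into cyclic modules along a divisibility chain. Existence: the primary
decomposition is sorted into a chain by replacing pairs of generators by their gcd and lcm
(`exists_chain_insert`). Uniqueness: the dimensions of the kernels of all `Q` determine the chain,
since on `K[X]/(P)` the kernel has full dimension exactly when `P ∣ Q`.

Passing from `σ` to `e ⊕ σ` adds summands `K[X]/(X - 1)`. An invariant factor `P` prime to `X - 1`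
can absorb one of them, becoming `(X - 1)P`. After enough padding `X - 1` divides every factor
(`exists_pad_dvd`); from then on new blocks `[X - 1]`, which are `1 × 1` identities, merely stand in
front of the chain, so `F(e ⊕ σ) = e ⊕ F(σ)` (`frobeniusForm_pad`) and the class is stable.

Conjugacy in the limit is similarity at a large finite level, where the ordinary Frobenius form
decides it. -/

namespace StableGL

/-! ### Sums of cyclic modules -/

section CyclicSum

variable {R : Type*} [CommRing R]

/-- The direct sum of the cyclic modules `R/(a)`, for `a` in the list `L`. -/
abbrev CyclicSum (L : List R) : Type _ := ∀ i : Fin L.length, R ⧸ Ideal.span {L.get i}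

/-- Splitting off the first summand of a sum of cyclic modules. -/
def cyclicSumCons (a : R) (L : List R) :
    CyclicSum (a :: L) ≃ₗ[R] (R ⧸ Ideal.span {a}) × CyclicSum L :=
  (Fin.consLinearEquiv R fun i : Fin (a :: L).length => R ⧸ Ideal.span {(a :: L).get i}).symm

theorem cyclicSum_cons_congr (a : R) {L L' : List R}
    (h : Nonempty (CyclicSum L ≃ₗ[R] CyclicSum L')) :
    Nonempty (CyclicSum (a :: L) ≃ₗ[R] CyclicSum (a :: L')) :=
  h.map fun e => (cyclicSumCons a L).trans
    (((LinearEquiv.refl R _).prodCongr e).trans (cyclicSumCons a L').symm)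

theorem cyclicSum_cons_cons_congr {a b c d : R} {L L' : List R}
    (h : Nonempty (((R ⧸ Ideal.span {a}) × (R ⧸ Ideal.span {b})) ≃ₗ[R]
      (R ⧸ Ideal.span {c}) × (R ⧸ Ideal.span {d})))
    (h' : Nonempty (CyclicSum L ≃ₗ[R] CyclicSum L')) :
    Nonempty (CyclicSum (a :: b :: L) ≃ₗ[R] CyclicSum (c :: d :: L')) := by
  obtain ⟨e⟩ := h
  obtain ⟨e'⟩ := h'
  have split : ∀ (a b : R) (L : List R), Nonempty (CyclicSum (a :: b :: L) ≃ₗ[R]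
      ((R ⧸ Ideal.span {a}) × (R ⧸ Ideal.span {b})) × CyclicSum L) := fun a b L =>
    ⟨(cyclicSumCons a _).trans (((LinearEquiv.refl R _).prodCongr (cyclicSumCons b L)).trans
      (LinearEquiv.prodAssoc R _ _ _).symm)⟩
  obtain ⟨e₁⟩ := split a b L
  obtain ⟨e₂⟩ := split c d L'
  exact ⟨e₁.trans ((e.prodCongr e').trans e₂.symm)⟩

theorem cyclicSum_perm {L L' : List R} (h : L.Perm L') :
    Nonempty (CyclicSum L ≃ₗ[R] CyclicSum L') := by
  induction h with
  | nil => exact ⟨LinearEquiv.refl R _⟩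
  | cons a _ ih => exact cyclicSum_cons_congr a ih
  | swap a b L =>
    exact cyclicSum_cons_cons_congr ⟨LinearEquiv.prodComm R _ _⟩ ⟨LinearEquiv.refl R _⟩
  | trans _ _ ih ih' => exact ⟨ih.some.trans ih'.some⟩

theorem cyclicSum_cons_of_isUnit {a : R} (h : IsUnit a) (L : List R) :
    Nonempty (CyclicSum (a :: L) ≃ₗ[R] CyclicSum L) := by
  have : Unique (R ⧸ Ideal.span {a}) :=
    @Unique.mk' _ _ (Ideal.Quotient.subsingleton_iff.2
      (Ideal.span_singleton_eq_top.2 h))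
  exact ⟨(cyclicSumCons a L).trans LinearEquiv.uniqueProd⟩

theorem cyclicSum_ofFn {n : ℕ} (f : Fin n → R) :
    Nonempty ((∀ i, R ⧸ Ideal.span {f i}) ≃ₗ[R] CyclicSum (List.ofFn f)) := by
  induction n with
  | zero =>
    rw [List.ofFn_zero]
    have : IsEmpty (Fin ([] : List R).length) := Fin.isEmpty
    exact ⟨LinearEquiv.ofSubsingleton _ _⟩
  | succ n ih =>
    obtain ⟨e⟩ := ih fun i => f i.succ
    rw [List.ofFn_succ]
    exact ⟨(Fin.consLinearEquiv R fun i => R ⧸ Ideal.span {f i}).symm.trans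
      (((LinearEquiv.refl R _).prodCongr e).trans (cyclicSumCons _ _).symm)⟩

/-- Multiplication by `c` as a map `R/(a) → R/(b)`, where `b ∣ c * a`. -/
def quotientMul {a b : R} (c : R) (h : b ∣ c * a) :
    (R ⧸ Ideal.span {a}) →ₗ[R] R ⧸ Ideal.span {b} :=
  Submodule.mapQ _ _ (LinearMap.mulLeft R c) <| by
    rw [Ideal.span, Submodule.span_le, Set.singleton_subset_iff]
    exact Ideal.mem_span_singleton.2 h

/-- `R/(a) ⊕ R/(b) ≅ R/(gcd) ⊕ R/(lcm)`. -/
theorem quotient_prod_equiv_gcd_lcm (d a b u v : R) (h : u * a + v * b = 1) :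
    Nonempty (((R ⧸ Ideal.span {d * a}) × (R ⧸ Ideal.span {d * b})) ≃ₗ[R]
      (R ⧸ Ideal.span {d}) × (R ⧸ Ideal.span {d * a * b})) := by
  -- The matrices with rows `(-u, v), (b, a)` and `(-a, v), (b, u)` are mutually inverse over `R`,
  -- because `u * a + v * b = 1`; their entries respect the ideals.
  let f₁ : (R ⧸ Ideal.span {d * a}) →ₗ[R] R ⧸ Ideal.span {d} :=
    quotientMul (-u) ⟨-u * a, by ring⟩
  let f₂ : (R ⧸ Ideal.span {d * b}) →ₗ[R] R ⧸ Ideal.span {d} := quotientMul v ⟨v * b, by ring⟩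
  let f₃ : (R ⧸ Ideal.span {d * a}) →ₗ[R] R ⧸ Ideal.span {d * a * b} :=
    quotientMul b ⟨1, by ring⟩
  let f₄ : (R ⧸ Ideal.span {d * b}) →ₗ[R] R ⧸ Ideal.span {d * a * b} :=
    quotientMul a ⟨1, by ring⟩
  let g₁ : (R ⧸ Ideal.span {d}) →ₗ[R] R ⧸ Ideal.span {d * a} := quotientMul (-a) ⟨-1, by ring⟩
  let g₂ : (R ⧸ Ideal.span {d * a * b}) →ₗ[R] R ⧸ Ideal.span {d * a} :=
    quotientMul v ⟨v * b, by ring⟩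
  let g₃ : (R ⧸ Ideal.span {d}) →ₗ[R] R ⧸ Ideal.span {d * b} := quotientMul b ⟨1, by ring⟩
  let g₄ : (R ⧸ Ideal.span {d * a * b}) →ₗ[R] R ⧸ Ideal.span {d * b} :=
    quotientMul u ⟨u * a, by ring⟩
  refine ⟨LinearEquiv.ofLinearMap ((f₁.coprod f₂).prod (f₃.coprod f₄))
    ((g₁.coprod g₂).prod (g₃.coprod g₄)) (LinearMap.ext ?_) (LinearMap.ext ?_)⟩
  all_goals
    rintro ⟨x, y⟩
    obtain ⟨x, rfl⟩ := Ideal.Quotient.mk_surjective x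
    obtain ⟨y, rfl⟩ := Ideal.Quotient.mk_surjective y
    refine Prod.ext (congrArg (Ideal.Quotient.mk _) ?_) (congrArg (Ideal.Quotient.mk _) ?_) <;>
      simp only [LinearMap.mulLeft_apply]
  · linear_combination x * h
  · linear_combination y * h
  · linear_combination x * h
  · linear_combination y * h

end CyclicSum

/-! ### Existence of invariant factors -/

section Polynomial

variable {K : Type*} [Field K]

/-- The gcd of `Q` and the head of the chain becomes the new head, and their lcm is inserted into
the tail. The clause on common divisors `D` is carried through the induction to show that the new
head divides everything after it. -/
theorem exists_chain_insert {L : List K[X]} (hL : ∀ P ∈ L, P.Monic) (hc : L.Pairwise (· ∣ ·))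
    {Q : K[X]} (hQ : Q.Monic) :
    ∃ L' : List K[X], (∀ P ∈ L', P.Monic) ∧ L'.Pairwise (· ∣ ·) ∧
      (∀ D, D ∣ Q → (∀ P ∈ L, D ∣ P) → ∀ P ∈ L', D ∣ P) ∧
      Nonempty (CyclicSum (Q :: L) ≃ₗ[K[X]] CyclicSum L') := by
  classical
  induction L generalizing Q with
  | nil => exact ⟨[Q], by simpa, by simp, by simp, ⟨LinearEquiv.refl _ _⟩⟩
  | cons P L ih =>
    rw [List.pairwise_cons] at hc
    have hP : P.Monic := hL P (by simp)
    obtain ⟨a, ha⟩ := gcd_dvd_left Q P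
    obtain ⟨b, hb⟩ := gcd_dvd_right Q P
    set d := gcd Q P with hd
    have hd0 : d ≠ 0 := by
      rintro h
      rw [h, zero_mul] at ha
      exact hQ.ne_zero ha
    have hdm : d.Monic := by
      have : normalize d = d := normalize_gcd Q P
      rw [← this]
      exact Polynomial.monic_normalize hd0
    have ham : a.Monic := hdm.of_mul_monic_left (ha ▸ hQ)
    have hbm : b.Monic := hdm.of_mul_monic_left (hb ▸ hP)
    obtain ⟨u, v, huv⟩ : ∃ u v : K[X], u * a + v * b = 1 := by
      obtain ⟨u, v, h⟩ := exists_gcd_eq_mul_add_mul Q P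
      refine ⟨u, v, mul_left_cancel₀ hd0 ?_⟩
      rw [← hd] at h
      linear_combination -h - u * ha - v * hb
    -- The lcm of `Q` and `P`.
    obtain ⟨m, hm⟩ : ∃ m, m = d * a * b := ⟨_, rfl⟩
    obtain ⟨L', h₁, h₂, h₃, h₄⟩ := ih (Q := m) (fun P h => hL P (by simp [h])) hc.2
      (hm ▸ (hdm.mul ham).mul hbm)
    have hdP : d ∣ P := ⟨b, hb⟩
    refine ⟨d :: L', ?_, ?_, ?_, ?_⟩
    · simpa using ⟨hdm, h₁⟩
    · exact List.pairwise_cons.2 ⟨h₃ d ⟨a * b, by rw [hm]; ring⟩ fun P' h => hdP.trans (hc.1 P' h), h₂⟩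
    · intro D hDQ hDL P' hP'
      have hDd : D ∣ d := dvd_gcd hDQ (hDL P (by simp))
      rcases List.mem_cons.1 hP' with rfl | hP'
      · exact hDd
      · exact h₃ D (hDd.trans ⟨a * b, by rw [hm]; ring⟩) (fun P h => hDL P (by simp [h])) P' hP'
    · obtain ⟨e⟩ := cyclicSum_cons_cons_congr (L := L) (L' := L)
        (quotient_prod_equiv_gcd_lcm d a b u v huv) ⟨LinearEquiv.refl _ _⟩
      rw [← hm, ← ha, ← hb] at e
      obtain ⟨e'⟩ := cyclicSum_cons_congr d h₄
      exact ⟨e.trans e'⟩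

theorem exists_chain (L : List K[X]) (hL : ∀ P ∈ L, P.Monic) :
    ∃ L' : List K[X], (∀ P ∈ L', P.Monic) ∧ L'.Pairwise (· ∣ ·) ∧
      Nonempty (CyclicSum L ≃ₗ[K[X]] CyclicSum L') := by
  induction L with
  | nil => exact ⟨[], by simp, by simp, ⟨LinearEquiv.refl _ _⟩⟩
  | cons Q L ih =>
    obtain ⟨L₁, h₁, h₂, h₃⟩ := ih fun P h => hL P (by simp [h])
    obtain ⟨L₂, h₄, h₅, -, h₆⟩ := exists_chain_insert h₁ h₂ (hL Q (by simp))
    obtain ⟨e⟩ := cyclicSum_cons_congr Q h₃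
    exact ⟨L₂, h₄, h₅, ⟨e.trans h₆.some⟩⟩

theorem cyclicSum_filter_nonconstant (L : List K[X]) (hL : ∀ P ∈ L, P.Monic) :
    Nonempty (CyclicSum L ≃ₗ[K[X]] CyclicSum (L.filter fun P => 0 < P.natDegree)) := by
  induction L with
  | nil => exact ⟨LinearEquiv.refl _ _⟩
  | cons P L ih =>
    have ih := ih fun P h => hL P (by simp [h])
    by_cases hP : 0 < P.natDegree
    · rw [List.filter_cons_of_pos (by simpa using hP)]
      exact cyclicSum_cons_congr P ih
    · rw [List.filter_cons_of_neg (by simpa using hP)]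
      have : P = 1 := (hL P (by simp)).natDegree_eq_zero.1 (by omega)
      obtain ⟨e⟩ := cyclicSum_cons_of_isUnit (this ▸ isUnit_one : IsUnit P) L
      exact ⟨e.trans ih.some⟩

/-- A finitely generated torsion module over `K[X]` has a system of invariant factors. -/
theorem exists_invariant_factors (M : Type*) [AddCommGroup M] [Module K[X] M]
    [Module.Finite K[X] M] (hM : Module.IsTorsion K[X] M) :
    ∃ L : List K[X], (∀ P ∈ L, P.Monic) ∧ (∀ P ∈ L, 0 < P.natDegree) ∧ L.Pairwise (· ∣ ·) ∧
      Nonempty (M ≃ₗ[K[X]] CyclicSum L) := by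
  classical
  -- Primary decomposition; normalizing makes the prime powers monic without changing their ideals.
  obtain ⟨ι, _, p, hp, k, ⟨e⟩⟩ := Module.equiv_directSum_of_isTorsion hM
  let f : Fin (Fintype.card ι) → K[X] := fun i =>
    normalize (p ((Fintype.equivFin ι).symm i) ^ k ((Fintype.equivFin ι).symm i))
  have hf : ∀ P ∈ List.ofFn f, P.Monic := by
    intro P hP
    obtain ⟨i, rfl⟩ := (List.mem_ofFn' _ _).1 hP
    exact Polynomial.monic_normalize (pow_ne_zero _ (hp _).ne_zero)
  have e₁ := e.trans (DirectSum.linearEquivFunOnFintype K[X] ι _)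
  have e₂ := e₁.trans (LinearEquiv.piCongrLeft K[X] (fun i => K[X] ⧸ K[X] ∙ p i ^ k i)
    (Fintype.equivFin ι).symm).symm
  have e₃ := e₂.trans (LinearEquiv.piCongrRight fun i => Submodule.quotEquivOfEq _
    (Ideal.span {f i}) (Ideal.span_singleton_eq_span_singleton.2 (normalize_associated _).symm))
  obtain ⟨e₄⟩ := cyclicSum_ofFn f
  obtain ⟨L, h₁, h₂, ⟨e₅⟩⟩ := exists_chain _ hf
  obtain ⟨e₆⟩ := cyclicSum_filter_nonconstant L h₁
  exact ⟨_, fun P h => h₁ P (List.mem_of_mem_filter h), fun P h => by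
    simpa using List.of_mem_filter h, h₂.filter _, ⟨((e₃.trans e₄).trans e₅).trans e₆⟩⟩

end Polynomial

/-! ### Uniqueness of invariant factors -/

section Uniqueness

variable {K : Type*} [Field K]

/-- The dimension of the `Q`-torsion of a `K[X]`-module. -/
noncomputable def torsionRank (Q : K[X]) (M : Type*) [AddCommGroup M] [Module K M] [Module K[X] M]
    [IsScalarTower K K[X] M] : ℕ :=
  Module.finrank K (LinearMap.ker (Algebra.lsmul K K M Q))

theorem torsionRank_congr (Q : K[X]) {M N : Type*} [AddCommGroup M] [Module K M] [Module K[X] M]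
    [IsScalarTower K K[X] M] [AddCommGroup N] [Module K N] [Module K[X] N]
    [IsScalarTower K K[X] N] (e : M ≃ₗ[K[X]] N) : torsionRank Q M = torsionRank Q N := by
  have : (LinearMap.ker (Algebra.lsmul K K M Q)).map (e.restrictScalars K : M →ₗ[K] N) =
      LinearMap.ker (Algebra.lsmul K K N Q) := by
    ext x
    constructor
    · rintro ⟨y, hy, rfl⟩
      have hy : Q • y = 0 := hy
      simp [← map_smul, hy]
    · intro hx
      have hx : Q • x = 0 := hx
      refine ⟨e.symm x, ?_, by simp⟩
      simp [← map_smul, hx]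
  rw [torsionRank, torsionRank, ← this, LinearEquiv.finrank_map_eq]

theorem torsionRank_prod (Q : K[X]) {M N : Type*} [AddCommGroup M] [Module K M] [Module K[X] M]
    [IsScalarTower K K[X] M] [AddCommGroup N] [Module K N] [Module K[X] N]
    [IsScalarTower K K[X] N] [FiniteDimensional K M] [FiniteDimensional K N] :
    torsionRank Q (M × N) = torsionRank Q M + torsionRank Q N := by
  rw [torsionRank, torsionRank, torsionRank, ← Module.finrank_prod]
  refine LinearEquiv.finrank_eq
    { toFun x := (⟨x.1.1, congrArg Prod.fst x.2⟩, ⟨x.1.2, congrArg Prod.snd x.2⟩)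
      invFun x := ⟨(x.1, x.2), Prod.ext x.1.2 x.2.2⟩
      map_add' _ _ := rfl
      map_smul' _ _ := rfl
      left_inv _ := rfl
      right_inv _ := rfl }

theorem torsionRank_quotient_le (Q : K[X]) {P : K[X]} (hP : P.Monic) :
    torsionRank Q (K[X] ⧸ Ideal.span {P}) ≤ P.natDegree := by
  have : FiniteDimensional K (K[X] ⧸ Ideal.span {P}) := hP.finite_quotient
  rw [← finrank_quotient_span_eq_natDegree (f := P)]
  exact Submodule.finrank_le _

/-- `Q` kills the cyclic module exactly when it kills the generator `1`, and a subspace of full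
dimension is the whole space. -/
theorem torsionRank_quotient_eq_iff (Q : K[X]) {P : K[X]} (hP : P.Monic) :
    torsionRank Q (K[X] ⧸ Ideal.span {P}) = P.natDegree ↔ P ∣ Q := by
  have : FiniteDimensional K (K[X] ⧸ Ideal.span {P}) := hP.finite_quotient
  rw [← finrank_quotient_span_eq_natDegree (f := P), torsionRank]
  have key : LinearMap.ker (Algebra.lsmul K K (K[X] ⧸ Ideal.span {P}) Q) = ⊤ ↔ P ∣ Q := by
    rw [← Ideal.mem_span_singleton, ← Ideal.Quotient.eq_zero_iff_mem]
    constructor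
    · intro h
      have h1 : (1 : K[X] ⧸ Ideal.span {P}) ∈
          LinearMap.ker (Algebra.lsmul K K (K[X] ⧸ Ideal.span {P}) Q) := h ▸ Submodule.mem_top
      have h2 : Ideal.Quotient.mk (Ideal.span {P}) (Q * 1) = 0 := h1
      rwa [mul_one] at h2
    · intro h
      refine eq_top_iff.2 fun x _ => ?_
      obtain ⟨x, rfl⟩ := Ideal.Quotient.mk_surjective x
      change Ideal.Quotient.mk (Ideal.span {P}) (Q * x) = 0
      rw [map_mul, h, zero_mul]
  rw [← key]
  exact ⟨Submodule.eq_top_of_finrank_eq, fun h => by rw [h, finrank_top]⟩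

theorem finiteDimensional_cyclicSum {L : List K[X]} (hL : ∀ P ∈ L, P.Monic) :
    FiniteDimensional K (CyclicSum L) := by
  have (i : Fin L.length) : FiniteDimensional K (K[X] ⧸ Ideal.span {L.get i}) :=
    (hL _ (L.get_mem i)).finite_quotient
  infer_instance

theorem torsionRank_cyclicSum (Q : K[X]) {L : List K[X]} (hL : ∀ P ∈ L, P.Monic) :
    torsionRank Q (CyclicSum L) =
      (L.map fun P => torsionRank Q (K[X] ⧸ Ideal.span {P})).sum := by
  induction L with
  | nil =>
    have : IsEmpty (Fin ([] : List K[X]).length) := Fin.isEmpty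
    exact Module.finrank_zero_of_subsingleton
  | cons P L ih =>
    have hL' : ∀ P ∈ L, P.Monic := fun P h => hL P (by simp [h])
    have := finiteDimensional_cyclicSum hL'
    have : FiniteDimensional K (K[X] ⧸ Ideal.span {P}) := (hL P (by simp)).finite_quotient
    rw [torsionRank_congr Q (cyclicSumCons P L), torsionRank_prod, ih hL', List.map_cons,
      List.sum_cons]

theorem eq_of_sum_map_le {α : Type*} {L : List α} {f g : α → ℕ} (h : ∀ a ∈ L, f a ≤ g a)
    (hs : (L.map g).sum ≤ (L.map f).sum) : ∀ a ∈ L, f a = g a := by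
  induction L with
  | nil => simp
  | cons b L ih =>
    have h' : ∀ a ∈ L, f a ≤ g a := fun a ha => h a (by simp [ha])
    have h₁ := List.sum_le_sum h'
    have h₂ := h b (by simp)
    simp only [List.map_cons, List.sum_cons] at hs
    intro a ha
    rcases List.mem_cons.1 ha with rfl | ha
    · omega
    · exact ih h' (by omega) a ha

/-- `Q = 0` shows that both lists have the same total degree. At `Q = P` the sum over `L` reaches
it, hence so does the sum over `L'`; each term is at most a degree, so equality holds termwise. -/
theorem dvd_of_sum_torsionRank_eq {P : K[X]} {L L' : List K[X]} (hL : ∀ P ∈ L, P.Monic)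
    (hL' : ∀ P ∈ L', P.Monic) (hP : ∀ P' ∈ L, P' ∣ P)
    (h : ∀ Q : K[X], (L.map fun P => torsionRank Q (K[X] ⧸ Ideal.span {P})).sum =
      (L'.map fun P => torsionRank Q (K[X] ⧸ Ideal.span {P})).sum) : ∀ P' ∈ L', P' ∣ P := by
  have key : (L'.map natDegree).sum ≤
      (L'.map fun P' => torsionRank P (K[X] ⧸ Ideal.span {P'})).sum := by
    rw [← h P, List.map_congr_left fun P' hP' =>
        (torsionRank_quotient_eq_iff P (hL P' hP')).2 (hP P' hP'),
      List.map_congr_left fun P' hP' =>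
        ((torsionRank_quotient_eq_iff 0 (hL' P' hP')).2 (dvd_zero P')).symm, ← h 0]
    exact List.sum_le_sum fun P' hP' => torsionRank_quotient_le 0 (hL P' hP')
  intro P' hP'
  exact (torsionRank_quotient_eq_iff P (hL' P' hP')).1 (eq_of_sum_map_le
    (fun a ha => torsionRank_quotient_le P (hL' a ha)) key P' hP')

/-- With the largest factor first, the heads divide each other; they cancel from the sums and the
tails follow by induction. -/
theorem eq_of_sum_torsionRank_eq {L L' : List K[X]} (hL : ∀ P ∈ L, P.Monic)
    (hL' : ∀ P ∈ L', P.Monic) (hn : ∀ P ∈ L, 0 < P.natDegree) (hn' : ∀ P ∈ L', 0 < P.natDegree)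
    (hc : L.Pairwise fun P P' => P' ∣ P) (hc' : L'.Pairwise fun P P' => P' ∣ P)
    (h : ∀ Q : K[X], (L.map fun P => torsionRank Q (K[X] ⧸ Ideal.span {P})).sum =
      (L'.map fun P => torsionRank Q (K[X] ⧸ Ideal.span {P})).sum) : L = L' := by
  have not_one : ∀ P : K[X], 0 < P.natDegree → ¬ P ∣ 1 := fun P hP h =>
    hP.ne' (natDegree_eq_zero_of_isUnit (isUnit_of_dvd_one h))
  induction L generalizing L' with
  | nil =>
    cases L' with
    | nil => rfl
    | cons P' L' =>
      -- Everything in the empty list divides `1`, so the nonconstant `P'` would too.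
      exact absurd (dvd_of_sum_torsionRank_eq (P := 1) hL hL' (by simp) h P' (by simp))
        (not_one P' (hn' P' (by simp)))
  | cons P L ih =>
    cases L' with
    | nil =>
      exact absurd (dvd_of_sum_torsionRank_eq (P := 1) hL' hL (by simp) (fun Q => (h Q).symm) P
        (by simp)) (not_one P (hn P (by simp)))
    | cons P' L' =>
      rw [List.pairwise_cons] at hc hc'
      have h₁ : P' ∣ P := dvd_of_sum_torsionRank_eq hL hL' (by simpa using hc.1) h P' (by simp)
      have h₂ : P ∣ P' := dvd_of_sum_torsionRank_eq hL' hL (by simpa using hc'.1)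
        (fun Q => (h Q).symm) P (by simp)
      obtain rfl : P = P' := eq_of_monic_of_associated (hL P (by simp)) (hL' P' (by simp))
        (associated_of_dvd_dvd h₂ h₁)
      rw [ih (fun P h => hL P (by simp [h])) (fun P h => hL' P (by simp [h]))
        (fun P h => hn P (by simp [h])) (fun P h => hn' P (by simp [h])) hc.2 hc'.2
        fun Q => by simpa using h Q]

/-- The invariant factors of a `K[X]`-module are unique. -/
theorem invariant_factors_unique {L L' : List K[X]} (hL : ∀ P ∈ L, P.Monic)
    (hL' : ∀ P ∈ L', P.Monic) (hn : ∀ P ∈ L, 0 < P.natDegree) (hn' : ∀ P ∈ L', 0 < P.natDegree)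
    (hc : L.Pairwise (· ∣ ·)) (hc' : L'.Pairwise (· ∣ ·))
    (e : CyclicSum L ≃ₗ[K[X]] CyclicSum L') : L = L' := by
  refine List.reverse_injective (eq_of_sum_torsionRank_eq (by simpa) (by simpa) (by simpa)
    (by simpa) (List.pairwise_reverse.2 hc) (List.pairwise_reverse.2 hc') fun Q => ?_)
  rw [List.map_reverse, List.map_reverse, List.sum_reverse, List.sum_reverse,
    ← torsionRank_cyclicSum Q hL, ← torsionRank_cyclicSum Q hL', torsionRank_congr Q e]

end Uniqueness

/-! ### Matrices as `K[X]`-modules -/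

section Matrix

variable {K : Type*} [Field K]

/-- The `K[X]`-module defined by the matrix `σ` is isomorphic to the sum of the modules
`K[X]/(P)`, for `P` in the list `L`. -/
def HasCyclicFactors {n : ℕ} (σ : Matrix (Fin n) (Fin n) K) (L : List K[X]) : Prop :=
  Nonempty (Module.AEval' (Matrix.toLin' σ) ≃ₗ[K[X]] CyclicSum L)

theorem similar_iff {n : ℕ} {σ τ : Matrix (Fin n) (Fin n) K} :
    Similar σ τ ↔
      Nonempty (Module.AEval' (Matrix.toLin' σ) ≃ₗ[K[X]] Module.AEval' (Matrix.toLin' τ)) := by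
  constructor
  · rintro ⟨ρ, rfl⟩
    -- For `σ = ρ τ ρ⁻¹` the map `v ↦ ρ⁻¹ v` carries the action of `σ` to that of `τ`.
    refine ⟨LinearEquiv.ofAEval _ ((Matrix.toLin'OfInv (M := ρ.val)
      (M' := (ρ⁻¹ : GL (Fin n) K).val) (by simp) (by simp)).trans (Module.AEval'.of (Matrix.toLin' τ)))
      fun v => ?_⟩
    rw [LinearEquiv.trans_apply, LinearEquiv.trans_apply, Module.AEval'.X_smul_of]
    congr 1
    change (ρ⁻¹ : GL (Fin n) K).val.mulVec ((ρ.val * τ * (ρ⁻¹ : GL (Fin n) K).val).mulVec v) =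
      τ.mulVec ((ρ⁻¹ : GL (Fin n) K).val.mulVec v)
    rw [Matrix.mulVec_mulVec, Matrix.mulVec_mulVec, ← mul_assoc, ← mul_assoc, Units.inv_mul,
      one_mul]
  · rintro ⟨e⟩
    let f : (Fin n → K) ≃ₗ[K] (Fin n → K) := (Module.AEval'.of (Matrix.toLin' σ)).trans
      ((e.restrictScalars K).trans (Module.AEval'.of (Matrix.toLin' τ)).symm)
    have hf (v) : f (Matrix.toLin' σ v) = Matrix.toLin' τ (f v) := by
      change (Module.AEval'.of (Matrix.toLin' τ)).symm (e (Module.AEval'.of (Matrix.toLin' σ)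
        (Matrix.toLin' σ v))) = _
      rw [← Module.AEval'.X_smul_of, map_smul, Module.AEval'.of_symm_X_smul]
      rfl
    refine ⟨⟨LinearMap.toMatrix' f.symm.toLinearMap, LinearMap.toMatrix' f.toLinearMap, ?_, ?_⟩, ?_⟩
    · rw [← LinearMap.toMatrix'_comp]
      simp
    · rw [← LinearMap.toMatrix'_comp]
      simp
    · apply Matrix.toLin'.injective
      refine LinearMap.ext fun v => ?_
      simp only [Units.inv_mk, Matrix.toLin'_mul, Matrix.toLin'_toMatrix', LinearMap.comp_apply,
        LinearEquiv.coe_coe]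
      rw [← hf, LinearEquiv.symm_apply_apply]

theorem Similar.symm {n : ℕ} {σ τ : Matrix (Fin n) (Fin n) K} (h : Similar σ τ) : Similar τ σ :=
  similar_iff.2 ((similar_iff.1 h).map LinearEquiv.symm)

theorem Similar.trans {n : ℕ} {ρ σ τ : Matrix (Fin n) (Fin n) K} (h : Similar ρ σ)
    (h' : Similar σ τ) : Similar ρ τ :=
  similar_iff.2 ⟨(similar_iff.1 h).some.trans (similar_iff.1 h').some⟩

theorem HasCyclicFactors.of_similar {n : ℕ} {σ τ : Matrix (Fin n) (Fin n) K} {L : List K[X]}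
    (hτ : HasCyclicFactors τ L) (h : Similar σ τ) : HasCyclicFactors σ L :=
  ⟨(similar_iff.1 h).some.trans hτ.some⟩

theorem HasCyclicFactors.similar {n : ℕ} {σ τ : Matrix (Fin n) (Fin n) K} {L : List K[X]}
    (hσ : HasCyclicFactors σ L) (hτ : HasCyclicFactors τ L) : Similar σ τ :=
  similar_iff.2 ⟨hσ.some.trans hτ.some.symm⟩

/-- The companion matrix is multiplication by `X` in the basis `1, X, ..., X^(d-1)` of `K[X]/(P)`.
-/
theorem aeval_companion_equiv {P : K[X]} (hP : P.Monic) :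
    Nonempty (Module.AEval' (Matrix.toLin' (companion P)) ≃ₗ[K[X]] K[X] ⧸ Ideal.span {P}) := by
  let g : (Fin P.natDegree → K) ≃ₗ[K] AdjoinRoot P := (AdjoinRoot.powerBasisAux' hP).equivFun.symm
  have hg (w : Fin P.natDegree → K) :
      g w = AdjoinRoot.mk P (∑ i : Fin P.natDegree, C (w i) * X ^ (i : ℕ)) := by
    refine (Module.Basis.equivFun_symm_apply _ _).trans ?_
    rw [map_sum]
    refine Finset.sum_congr rfl fun i _ => ?_
    rw [map_mul, AdjoinRoot.mk_C, map_pow, AdjoinRoot.mk_X, Algebra.smul_def]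
    exact congrArg _ ((AdjoinRoot.powerBasis' hP).basis_eq_pow i)
  let f : (Fin P.natDegree → K) ≃ₗ[K] (K[X] ⧸ Ideal.span {P}) := g
  have hf (w : Fin P.natDegree → K) :
      f w = Ideal.Quotient.mk (Ideal.span {P}) (∑ i : Fin P.natDegree, C (w i) * X ^ (i : ℕ)) :=
    hg w
  refine ⟨LinearEquiv.ofAEval _ f fun v => ?_⟩
  have key : f.toLinearMap ∘ₗ Matrix.toLin' (companion P) =
      Algebra.lsmul K K (K[X] ⧸ Ideal.span {P}) (X : K[X]) ∘ₗ f.toLinearMap := by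
    refine LinearMap.pi_ext' fun j => LinearMap.ext_ring ?_
    change f (Matrix.toLin' (companion P) (Pi.single j 1)) = (X : K[X]) • f (Pi.single j 1)
    have h₁ : f (Pi.single j 1) = Ideal.Quotient.mk (Ideal.span {P}) (X ^ (j : ℕ)) := by
      rw [hf, Finset.sum_eq_single j (fun i _ hij => by simp [hij]) (by simp)]
      simp
    rw [h₁, hf, Matrix.toLin'_apply, Matrix.mulVec_single_one]
    change _ = Ideal.Quotient.mk (Ideal.span {P}) (X * X ^ (j : ℕ))
    rw [← pow_succ']
    by_cases hj : (j : ℕ) + 1 = P.natDegree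
    -- Last column: `X^d` is reduced modulo `P`.
    · rw [Ideal.Quotient.eq, Ideal.mem_span_singleton]
      refine ⟨-1, ?_⟩
      have h₂ := hP.as_sum
      rw [Finset.sum_range] at h₂
      simp only [Matrix.col_apply, companion, Matrix.of_apply, hj, if_true, map_neg, neg_mul,
        Finset.sum_neg_distrib]
      linear_combination h₂
    · congr 1
      rw [Finset.sum_eq_single ⟨j + 1, by omega⟩]
      · simp [companion, hj]
      · intro i _ hi
        have : (i : ℕ) ≠ j + 1 := fun h => hi (Fin.ext h)
        simp [companion, hj, this]
      · simp
  exact LinearMap.congr_fun key v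

theorem aeval_directSum_equiv {m n : ℕ} (σ : Matrix (Fin m) (Fin m) K)
    (τ : Matrix (Fin n) (Fin n) K) :
    Nonempty (Module.AEval' (Matrix.toLin' (directSum σ τ)) ≃ₗ[K[X]]
      Module.AEval' (Matrix.toLin' σ) × Module.AEval' (Matrix.toLin' τ)) := by
  let f : (Fin (m + n) → K) ≃ₗ[K] (Fin m → K) × (Fin n → K) :=
    (LinearEquiv.funCongrLeft K K finSumFinEquiv).trans
      (LinearEquiv.sumArrowLequivProdArrow (Fin m) (Fin n) K K)
  refine ⟨LinearEquiv.ofAEval _ (f.trans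
    ((Module.AEval'.of (Matrix.toLin' σ)).prodCongr (Module.AEval'.of (Matrix.toLin' τ))))
    fun v => ?_⟩
  have key : f (Matrix.toLin' (directSum σ τ) v) =
      (Matrix.toLin' σ (f v).1, Matrix.toLin' τ (f v).2) := by
    refine Prod.ext (funext fun i => ?_) (funext fun i => ?_)
    · change ∑ k, directSum σ τ (Fin.castAdd n i) k * v k = ∑ k, σ i k * v (Fin.castAdd n k)
      simp [Fin.sum_univ_add, directSum]
    · change ∑ k, directSum σ τ (Fin.natAdd m i) k * v k = ∑ k, τ i k * v (Fin.natAdd m k)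
      simp [Fin.sum_univ_add, directSum]
  refine (congrArg ((Module.AEval'.of (Matrix.toLin' σ)).prodCongr
    (Module.AEval'.of (Matrix.toLin' τ))) key).trans ?_
  refine Prod.ext ?_ ?_
  · exact (Module.AEval'.X_smul_of (Matrix.toLin' σ) (f v).1).symm
  · exact (Module.AEval'.X_smul_of (Matrix.toLin' τ) (f v).2).symm

theorem HasCyclicFactors.castSize {m n : ℕ} {σ : Matrix (Fin m) (Fin m) K} {L : List K[X]}
    (hσ : HasCyclicFactors σ L) (h : m = n) : HasCyclicFactors (castSize h σ) L := by
  subst h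
  exact hσ

theorem hasCyclicFactors_companionSum {L : List K[X]} (hL : ∀ P ∈ L, P.Monic) :
    HasCyclicFactors (companionSum L) L := by
  induction L with
  | nil =>
    have : IsEmpty (Fin ([] : List K[X]).length) := Fin.isEmpty
    have : Subsingleton (Module.AEval' (Matrix.toLin' (companionSum ([] : List K[X])))) :=
      inferInstanceAs (Subsingleton (Fin 0 → K))
    exact ⟨LinearEquiv.ofSubsingleton _ _⟩
  | cons P L ih =>
    refine HasCyclicFactors.castSize ?_ _
    obtain ⟨e⟩ := aeval_companion_equiv (hL P (by simp))
    obtain ⟨e'⟩ := ih fun P h => hL P (by simp [h])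
    obtain ⟨e''⟩ := aeval_directSum_equiv (companion P) (companionSum L)
    exact ⟨e''.trans ((e.prodCongr e').trans (cyclicSumCons P L).symm)⟩

end Matrix

/-! ### Frobenius forms and padding -/

section FrobeniusForm

variable {K : Type*} [Field K]

theorem IsInvariantFactors.hasCyclicFactors {n : ℕ} {σ : Matrix (Fin n) (Fin n) K}
    {L : List K[X]} (h : IsInvariantFactors σ L) : HasCyclicFactors σ L := by
  obtain ⟨h', hs⟩ := h.similar
  exact ((hasCyclicFactors_companionSum h.monic).castSize h').of_similar hs

theorem isInvariantFactors_of_hasCyclicFactors {n : ℕ} {σ : Matrix (Fin n) (Fin n) K}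
    {L : List K[X]} (hσ : HasCyclicFactors σ L) (hm : ∀ P ∈ L, P.Monic)
    (hn : ∀ P ∈ L, 0 < P.natDegree) (hc : L.Pairwise (· ∣ ·)) : IsInvariantFactors σ L := by
  have hL := hasCyclicFactors_companionSum hm
  -- Isomorphic modules have equal `K`-dimension.
  have h : (L.map natDegree).sum = n := by
    have e := (((Module.AEval'.of (Matrix.toLin' (companionSum L))).trans
      ((hL.some.trans hσ.some.symm).restrictScalars K)).trans
        (Module.AEval'.of (Matrix.toLin' σ)).symm).finrank_eq
    simpa using e
  exact ⟨hm, hn, hc.isChain, h, hσ.similar (hL.castSize h)⟩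

theorem IsInvariantFactors.unique {n : ℕ} {σ : Matrix (Fin n) (Fin n) K} {L L' : List K[X]}
    (h : IsInvariantFactors σ L) (h' : IsInvariantFactors σ L') : L = L' :=
  invariant_factors_unique h.monic h'.monic h.nonconstant h'.nonconstant
    (List.isChain_iff_pairwise.1 h.chain) (List.isChain_iff_pairwise.1 h'.chain)
    (h.hasCyclicFactors.some.symm.trans h'.hasCyclicFactors.some)

theorem exists_isInvariantFactors {n : ℕ} (σ : Matrix (Fin n) (Fin n) K) :
    ∃ L : List K[X], IsInvariantFactors σ L := by
  obtain ⟨L, hm, hn, hc, hL⟩ := exists_invariant_factors (Module.AEval' (Matrix.toLin' σ))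
    (Module.AEval.isTorsion_of_finiteDimensional K (Fin n → K) (Matrix.toLin' σ))
  exact ⟨L, isInvariantFactors_of_hasCyclicFactors hL hm hn hc⟩

theorem IsInvariantFactors.of_similar {n : ℕ} {σ τ : Matrix (Fin n) (Fin n) K} {L : List K[X]}
    (hτ : IsInvariantFactors τ L) (h : Similar σ τ) : IsInvariantFactors σ L :=
  ⟨hτ.monic, hτ.nonconstant, hτ.chain, hτ.similar.choose, h.trans hτ.similar.choose_spec⟩

theorem IsInvariantFactors.frobeniusForm_eq {n : ℕ} {σ : Matrix (Fin n) (Fin n) K}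
    {L : List K[X]} (h : IsInvariantFactors σ L) (h' : (L.map natDegree).sum = n) :
    frobeniusForm σ = castSize h' (companionSum L) := by
  have hex : ∃ L : List K[X], IsInvariantFactors σ L := ⟨L, h⟩
  -- The matrix size depends on the list, so equality of lists is substituted with the size proof
  -- left free.
  have congr : ∀ {L₁ : List K[X]} (_ : L₁ = L) (h₁ : (L₁.map natDegree).sum = n),
      castSize h₁ (companionSum L₁) = castSize h' (companionSum L) := by
    rintro _ rfl _
    rfl
  rw [frobeniusForm, dif_pos hex]
  exact congr (hex.choose_spec.unique h) _

theorem similar_iff_frobeniusForm_eq {n : ℕ} {σ τ : Matrix (Fin n) (Fin n) K} :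
    Similar σ τ ↔ frobeniusForm σ = frobeniusForm τ := by
  constructor
  · intro h
    obtain ⟨L, hL⟩ := exists_isInvariantFactors τ
    rw [(hL.of_similar h).frobeniusForm_eq hL.similar.choose,
      hL.frobeniusForm_eq hL.similar.choose]
  · intro h
    exact (similar_frobeniusForm σ).trans (h ▸ (similar_frobeniusForm τ).symm)

theorem castSize_directSum_eq_pad {a m n : ℕ} {A : Matrix (Fin a) (Fin a) K} (hA : A = 1)
    (h : a + m = n) (h' : m ≤ n) (τ : Matrix (Fin m) (Fin m) K) :
    castSize h (directSum A τ) = pad h' τ := by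
  obtain rfl : a = n - m := by omega
  subst hA
  rfl

theorem companion_X_sub_C_one : companion (X - C 1 : K[X]) = 1 := by
  ext i j
  have hi : (i : ℕ) = 0 := by
    have := i.2.trans_eq (natDegree_X_sub_C (1 : K))
    omega
  have hj : (j : ℕ) = 0 := by
    have := j.2.trans_eq (natDegree_X_sub_C (1 : K))
    omega
  obtain rfl : i = j := Fin.ext (hi.trans hj.symm)
  simp only [companion, Matrix.of_apply, natDegree_X_sub_C, hi, Matrix.one_apply_eq]
  simp

/-- Since `[X - 1]` is the `1 × 1` identity, this is an equality of matrices, not only a similarity.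
-/
theorem pad_companionSum (k : ℕ) {m n : ℕ} {L : List K[X]} (h : (L.map natDegree).sum = m)
    (h' : ((List.replicate k (X - C 1) ++ L).map natDegree).sum = n) (hmn : m ≤ n) :
    pad hmn (castSize h (companionSum L)) =
      castSize h' (companionSum (List.replicate k (X - C 1) ++ L)) := by
  subst h h'
  induction k with
  | zero => exact pad_self _
  | succ k ih =>
    have h₁ : (L.map natDegree).sum ≤
        ((List.replicate k (X - C 1) ++ L).map natDegree).sum := by simp
    have h₂ : ((List.replicate k (X - C 1) ++ L).map natDegree).sum ≤
        ((List.replicate (k + 1) (X - C 1) ++ L).map natDegree).sum := by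
      simp [List.replicate_succ]
    rw [← pad_pad h₁ h₂, ih h₁]
    exact (castSize_directSum_eq_pad companion_X_sub_C_one _ h₂ _).symm

theorem Similar.pad {m n : ℕ} {σ τ : Matrix (Fin m) (Fin m) K} (hs : Similar σ τ) (h : m ≤ n) :
    Similar (pad h σ) (pad h τ) := by
  obtain ⟨ρ, rfl⟩ := hs
  let f : Matrix (Fin m) (Fin m) K →* Matrix (Fin n) (Fin n) K :=
    { toFun := StableGL.pad h, map_one' := pad_one h, map_mul' := pad_mul h }
  refine ⟨Units.map f ρ, ?_⟩
  rw [pad_mul, pad_mul]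
  rfl

/-- `σ` may be replaced by the similar matrix `companionSum L`. No chain condition is needed, so
this applies before stabilization. -/
theorem HasCyclicFactors.pad {m k : ℕ} {σ : Matrix (Fin m) (Fin m) K} {L : List K[X]}
    (hσ : HasCyclicFactors σ L) (hL : ∀ P ∈ L, P.Monic) (hs : (L.map natDegree).sum = m)
    (h : m ≤ k + m) :
    HasCyclicFactors (pad h σ) (List.replicate k (X - C 1) ++ L) := by
  have hs' : ((List.replicate k (X - C 1 : K[X]) ++ L).map natDegree).sum = k + m := by
    simp only [List.map_append, List.map_replicate, natDegree_X_sub_C, List.sum_append,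
      List.sum_replicate, hs, smul_eq_mul, mul_one]
  have hL' : ∀ P ∈ List.replicate k (X - C 1) ++ L, P.Monic := by
    intro P hP
    rcases List.mem_append.1 hP with hP | hP
    · exact List.eq_of_mem_replicate hP ▸ monic_X_sub_C 1
    · exact hL P hP
  refine HasCyclicFactors.of_similar ?_
    ((hσ.similar ((hasCyclicFactors_companionSum hL).castSize hs)).pad h)
  rw [pad_companionSum k hs hs']
  exact (hasCyclicFactors_companionSum hL').castSize hs'

/-- The hypothesis `hd` is what keeps the list a chain when copies of `X - 1` are put in front. -/
theorem IsInvariantFactors.pad {m k : ℕ} {σ : Matrix (Fin m) (Fin m) K} {L : List K[X]}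
    (hσ : IsInvariantFactors σ L) (hd : ∀ P ∈ L, X - C 1 ∣ P) (h : m ≤ k + m) :
    IsInvariantFactors (pad h σ) (List.replicate k (X - C 1) ++ L) := by
  have mem {P : K[X]} (hP : P ∈ List.replicate k (X - C 1) ++ L) : P = X - C 1 ∨ P ∈ L :=
    (List.mem_append.1 hP).imp_left List.eq_of_mem_replicate
  refine isInvariantFactors_of_hasCyclicFactors
    (hσ.hasCyclicFactors.pad hσ.monic hσ.similar.choose h) ?_ ?_ ?_
  · intro P hP
    rcases mem hP with rfl | hP
    exacts [monic_X_sub_C 1, hσ.monic P hP]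
  · intro P hP
    rcases mem hP with rfl | hP
    exacts [by rw [natDegree_X_sub_C]; exact one_pos, hσ.nonconstant P hP]
  · refine List.pairwise_append.2 ⟨List.pairwise_replicate.2 (Or.inr dvd_rfl),
      List.isChain_iff_pairwise.1 hσ.chain, fun P hP P' hP' => ?_⟩
    rw [List.eq_of_mem_replicate hP]
    exact hd P' hP'

theorem frobeniusForm_pad {m n : ℕ} {σ : Matrix (Fin m) (Fin m) K} {L : List K[X]}
    (hσ : IsInvariantFactors σ L) (hd : ∀ P ∈ L, X - C 1 ∣ P) (h : m ≤ n) :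
    frobeniusForm (pad h σ) = pad h (frobeniusForm σ) := by
  obtain ⟨k, rfl⟩ : ∃ k, n = k + m := ⟨n - m, by omega⟩
  have hs := hσ.similar.choose
  have hp := hσ.pad hd h
  rw [hp.frobeniusForm_eq hp.similar.choose, hσ.frobeniusForm_eq hs, pad_companionSum]

-- Each factor not divisible by `X - 1` uses up one summand `K[X]/(X - 1)`, by the Chinese remainder
-- theorem; `k` counts these factors.
open Classical in
theorem exists_cyclicSum_saturate (L : List K[X]) :
    ∃ k : ℕ, Nonempty (CyclicSum (List.replicate k (X - C 1) ++ L) ≃ₗ[K[X]]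
      CyclicSum (L.map fun P => if X - C 1 ∣ P then P else (X - C 1) * P)) := by
  induction L with
  | nil => exact ⟨0, ⟨LinearEquiv.refl _ _⟩⟩
  | cons P L ih =>
    obtain ⟨k, hk⟩ := ih
    by_cases hP : X - C 1 ∣ P
    · refine ⟨k, ?_⟩
      rw [List.map_cons, if_pos hP]
      exact ⟨(cyclicSum_perm List.perm_middle).some.trans (cyclicSum_cons_congr P hk).some⟩
    · refine ⟨k + 1, ?_⟩
      rw [List.map_cons, if_neg hP]
      obtain ⟨u, v, huv⟩ := (irreducible_X_sub_C (1 : K)).coprime_iff_not_dvd.2 hP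
      -- With gcd `1` the first summand on the right is zero and is dropped by `e₂`.
      have h₁ := quotient_prod_equiv_gcd_lcm 1 _ _ u v huv
      rw [one_mul, one_mul] at h₁
      obtain ⟨e₁⟩ := cyclicSum_cons_cons_congr h₁ hk
      obtain ⟨e₂⟩ := cyclicSum_cons_of_isUnit (isUnit_one (M := K[X]))
        ((X - C 1) * P :: L.map fun P => if X - C 1 ∣ P then P else (X - C 1) * P)
      exact ⟨(cyclicSum_perm (List.perm_middle.cons _)).some.trans (e₁.trans e₂)⟩

theorem exists_pad_dvd {m : ℕ} (σ : Matrix (Fin m) (Fin m) K) :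
    ∃ (n : ℕ) (h : m ≤ n) (L : List K[X]), IsInvariantFactors (pad h σ) L ∧
      ∀ P ∈ L, X - C 1 ∣ P := by
  classical
  obtain ⟨L, hL⟩ := exists_isInvariantFactors σ
  obtain ⟨k, ⟨e⟩⟩ := exists_cyclicSum_saturate L
  have h : m ≤ k + m := by omega
  have hp := hL.hasCyclicFactors.pad hL.monic hL.similar.choose h
  refine ⟨k + m, h, _, isInvariantFactors_of_hasCyclicFactors ⟨hp.some.trans e⟩ ?_ ?_ ?_, ?_⟩
  · intro P' hP'
    obtain ⟨P, hP, rfl⟩ := List.mem_map.1 hP'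
    split_ifs
    exacts [hL.monic P hP, (monic_X_sub_C 1).mul (hL.monic P hP)]
  · intro P' hP'
    obtain ⟨P, hP, rfl⟩ := List.mem_map.1 hP'
    split_ifs
    · exact hL.nonconstant P hP
    · rw [(monic_X_sub_C 1).natDegree_mul (hL.monic P hP), natDegree_X_sub_C]
      omega
  -- The chain survives: `X - 1` cannot divide `P` without dividing `P'`, and if it divides only
  -- `P'`, coprimality gives `(X - 1)P ∣ P'`.
  · refine List.pairwise_map.2 ((List.isChain_iff_pairwise.1 hL.chain).imp ?_)
    intro P P' hPP'
    split_ifs with h₁ h₂ h₂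
    · exact hPP'
    · exact absurd (h₁.trans hPP') h₂
    · exact ((irreducible_X_sub_C (1 : K)).coprime_iff_not_dvd.2 h₁).mul_dvd h₂ hPP'
    · exact mul_dvd_mul_left _ hPP'
  · intro P' hP'
    obtain ⟨P, hP, rfl⟩ := List.mem_map.1 hP'
    split_ifs with h₁
    exacts [h₁, dvd_mul_right _ _]

end FrobeniusForm

/-! ### Passage to the limit group -/

section Stable

variable {K : Type*} [Field K]

theorem stableClass_mul {n : ℕ+} (σ τ : GL (Fin n) K) :
    stableClass (σ * τ) = stableClass σ * stableClass τ :=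
  (DirectLimit.mul_def (G := fun n : ℕ+ => GL (Fin n) K) (f := transition K) n σ τ).symm

theorem stableClass_representative (σ : GLInf K) (n : ℕ+) (h : minSize σ ≤ n) :
    stableClass (representative σ n h) = σ :=
  (existsUnique_representative σ n h).choose_spec.1

theorem transition_representative (σ : GLInf K) {m n : ℕ+} (h : minSize σ ≤ m) (h' : m ≤ n) :
    transition K m n h' (representative σ m h) = representative σ n (h.trans h') := by
  apply stableClass_injective
  rw [stableClass_transition, stableClass_representative, stableClass_representative]

theorem frobeniusGL_val {n : ℕ} (σ : GL (Fin n) K) :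
    (frobeniusGL σ : Matrix (Fin n) (Fin n) K) = frobeniusForm σ.val :=
  IsUnit.unit_spec _

theorem exists_stabilizesAt (σ : GLInf K) : ∃ s : ℕ+, StabilizesAt σ s := by
  obtain ⟨s, h, L, hL, hd⟩ := exists_pad_dvd (representative σ _ le_rfl).val
  lift s to ℕ+ using (minSize σ).pos.trans_le h
  have hs : minSize σ ≤ s := h
  replace hL : IsInvariantFactors (representative σ s hs).val L := by
    rw [← transition_representative σ le_rfl hs]
    exact hL
  refine ⟨s, hs, fun t ht => ?_⟩
  rw [← stableClass_transition ht, ← transition_representative σ hs ht]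
  congr 1
  apply Units.ext
  rw [frobeniusGL_val]
  refine Eq.trans ?_ (frobeniusForm_pad hL hd ht).symm
  rw [← frobeniusGL_val]
  rfl

theorem StabilizesAt.mono {σ : GLInf K} {s t : ℕ+} (h : StabilizesAt σ s) (hst : s ≤ t) :
    StabilizesAt σ t := by
  obtain ⟨hs, h⟩ := h
  exact ⟨hs.trans hst, fun u hu => (h t hst).symm.trans (h u (hst.trans hu))⟩

theorem StabilizesAt.stableFrobeniusForm_eq {σ : GLInf K} {s : ℕ+} (hσ : StabilizesAt σ s)
    (h : minSize σ ≤ s) :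
    stableFrobeniusForm σ = stableClass (frobeniusGL (representative σ s h)) := by
  have hex : ∃ s : ℕ+, StabilizesAt σ s := ⟨s, hσ⟩
  rw [stableFrobeniusForm, dif_pos hex]
  obtain ⟨h₁, h₂⟩ := hex.choose_spec
  obtain ⟨_, h₄⟩ := hσ
  -- Two stabilization levels are compared at their maximum.
  exact (h₂ _ (le_max_left _ s)).trans (h₄ _ (le_max_right _ s)).symm

theorem isConj_iff_stableFrobeniusForm_eq (σ τ : GLInf K) :
    IsConj σ τ ↔ stableFrobeniusForm σ = stableFrobeniusForm τ := by
  obtain ⟨s, hs⟩ := exists_stabilizesAt σ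
  obtain ⟨t, ht⟩ := exists_stabilizesAt τ
  -- Beyond both stabilization levels the two forms live in one `GL_n(K)`, which embeds in the
  -- limit.
  have key (n : ℕ+) (hsn : s ≤ n) (htn : t ≤ n) :
      stableFrobeniusForm σ = stableFrobeniusForm τ ↔
        Similar (representative σ n (hs.choose.trans hsn)).val
          (representative τ n (ht.choose.trans htn)).val := by
    rw [(hs.mono hsn).stableFrobeniusForm_eq (hs.choose.trans hsn),
      (ht.mono htn).stableFrobeniusForm_eq (ht.choose.trans htn),
      stableClass_injective.eq_iff, similar_iff_frobeniusForm_eq, ← frobeniusGL_val,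
      ← frobeniusGL_val, Units.ext_iff]
  constructor
  · intro h
    obtain ⟨ρ, hρ⟩ := isConj_iff.1 h.symm
    -- The level must also be large enough to represent the conjugating element `ρ`.
    obtain ⟨n, hsn, htn, hn⟩ : ∃ n, s ≤ n ∧ t ≤ n ∧ minSize ρ ≤ n :=
      ⟨max s (max t (minSize ρ)), le_max_left _ _, (le_max_left _ _).trans (le_max_right _ _),
        (le_max_right _ _).trans (le_max_right _ _)⟩
    refine (key n hsn htn).2 ⟨representative ρ n hn, ?_⟩
    have : representative σ n (hs.choose.trans hsn) * representative ρ n hn =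
        representative ρ n hn * representative τ n (ht.choose.trans htn) := by
      apply stableClass_injective
      simp only [stableClass_mul, stableClass_representative]
      rw [← hρ, inv_mul_cancel_right]
    rw [← Units.val_mul, ← Units.val_mul, ← this, mul_inv_cancel_right]
  · intro h
    obtain ⟨ρ, hρ⟩ := (key (max s t) (le_max_left _ _) (le_max_right _ _)).1 h
    rw [← Units.val_mul, ← Units.val_mul, ← Units.ext_iff, eq_mul_inv_iff_mul_eq] at hρ
    have := congrArg stableClass hρ
    simp only [stableClass_mul, stableClass_representative] at this
    exact (isConj_iff.2 ⟨stableClass ρ, mul_inv_eq_iff_eq_mul.2 this.symm⟩).symm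

end Stable

end StableGL

theorem mainTheorem8 {K : Type*} [Field K] :
    -- every matrix has exactly one system of invariant factors
    (∀ (n : ℕ+) (A : Matrix (Fin n) (Fin n) K),
      ∃! L : List (Polynomial K), StableGL.IsInvariantFactors A L) ∧
    -- the stabilized Frobenius form is well defined
    (∀ σ : StableGL.GLInf K,
      (∃ s : ℕ+, StableGL.StabilizesAt σ s) ∧
      ∀ (s : ℕ+) (h : StableGL.minSize σ ≤ s), StableGL.StabilizesAt σ s →
        StableGL.stableFrobeniusForm σ =
          StableGL.stableClass (StableGL.frobeniusGL (StableGL.representative σ s h))) ∧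
    -- it classifies the conjugacy classes
    (∀ σ τ : StableGL.GLInf K,
      IsConj σ τ ↔ StableGL.stableFrobeniusForm σ = StableGL.stableFrobeniusForm τ) := by
  refine ⟨fun n A => ?_, fun σ => ⟨StableGL.exists_stabilizesAt σ, fun s h hs =>
    hs.stableFrobeniusForm_eq h⟩, StableGL.isConj_iff_stableFrobeniusForm_eq⟩
  obtain ⟨L, hL⟩ := StableGL.exists_isInvariantFactors A
  exact ⟨L, hL, fun L' hL' => hL'.unique hL⟩
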